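/- Let $\mathcal X,\mathcal Y$ be finite-dimensional Euclidean spaces, let $\mathcal S^n$ be the space of real symmetric $n\times n$ matrices with the Frobenius inner product, $\mathcal S^n_+$ (resp. $\mathcal S^n_-$) the cone of positive (resp. negative) semidefinite matrices, and let products of these spaces carry the Euclidean product norm. Let $f:\mathcal X\to\mathbb R$, $h:\mathcal X\to\mathcal Y$, $G:\mathcal X\to\mathcal S^n$ be twice continuously differentiable, and consider the problem $$\min_{x\in\mathcal X} f(x)\quad\text{s.t. } h(x)=0,\ G(x)\in\mathcal S^n_+ ,$$ with Lagrangian $L(x,y,\Gamma)=f(x)+\langle y,h(x)\rangle+\langle\Gamma,G(x)\rangle$. For $(a_1,a_2,b)\in\mathcal X\times\mathcal Y\times\mathcal S^n$ let $$S_{\rm KKT}(a_1,a_2,b)=\{(x,y,\Gamma):\ \nabla_xL(x,y,\Gamma)-a_1=0,\ h(x)-a_2=0,\ \mathcal S^n_+\ni (G(x)-b)\perp\Gamma\in\mathcal S^n_-\},$$ and let $\mathcal M(x)=\{(y,\Gamma): (x,y,\Gamma)\in S_{\rm KKT}(0,0,0)\}$; $x$ is called stationary if $\mathcal M(x)\neq\emptyset$.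 For $X\in\mathcal S^n_+$ let $N_{\mathcal S^n_+}(X)$ be the normal cone of convex analysis and $T_{\mathcal S^n_+}(X)$ the Bouligand tangent cone. Put $$\mathcal G_1(x)=\{(y,\Gamma):\nabla f(x)+\nabla h(x)^*y+\nabla G(x)^*\Gamma=0\},\qquad \mathcal G_2(x)=\{(y,\Gamma):\Gamma\in N_{\mathcal S^n_+}(G(x))\}.$$ Let $\bar x$ be a stationary point and $(\bar y,\bar\Gamma)\in\mathcal M(\bar x)$. Assume: (i) the second-order sufficient condition (SOSC) holds at $(\bar x,\bar y,\bar\Gamma)$: for every $d\neq0$ in the critical cone $$\mathcal C(\bar x)=\{d\in\mathcal X:\ \nabla h(\bar x)d=0,\ \nabla G(\bar x)d\in T_{\mathcal S^n_+}(G(\bar x))\cap\bar\Gamma^{\perp}\}$$ one has $$\langle\nabla^2_{xx}L(\bar x,\bar y,\bar\Gamma)d,d\rangle-2\big\langle\bar\Gamma,(\nabla G(\bar x)d)\,G(\bar x)^{\dagger}\,(\nabla G(\bar x)d)\big\rangle>0,$$ where $G(\bar x)^\dagger$ is the Moore–Penrose inverse of $G(\bar x)$; (ii) $\mathcal G_1(\bar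 x)\cap\mathrm{ri}\,\mathcal G_2(\bar x)\neq\emptyset$, where $\mathrm{ri}$ denotes the relative interior. Then $S_{\rm KKT}$ is semi-isolatedly calm at $((0,0,0),(\bar x,\bar y,\bar\Gamma))$: there exist $\kappa_1>0$, $r_1>0$ and an open neighborhood $\mathbb U$ of $(0,0,0)$ such that for all $(a_1,a_2,b)\in\mathbb U$ and all $(x,y,\Gamma)\in S_{\rm KKT}(a_1,a_2,b)$ in the ball of radius $r_1$ centered at $(\bar x,\bar y,\bar\Gamma)$, $$\|x-\bar x\|+\mathrm{dist}\big((y,\Gamma),\mathcal M(\bar x)\big)\le\kappa_1\|(a_1,a_2,b)\|.$$ -/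

import Mathlib

open Filter Topology

noncomputable section

namespace NLSDP

/-! ### Symmetric matrices with the Frobenius inner product -/

/-- The symmetric `n × n` real matrices, as a subspace of the Euclidean space of all families
`(a (i, j))`; the inherited inner product is the Frobenius one (see `inner_eq_trace`). -/
def symSubmodule (n : ℕ) : Submodule ℝ (EuclideanSpace ℝ (Fin n × Fin n)) where
  carrier := {a | ∀ i j, a (i, j) = a (j, i)}
  add_mem' := by
    intro a b ha hb i j
    simp [ha i j, hb i j]
  zero_mem' := by
    intro i j
    simp
  smul_mem' := by
    intro c a ha i j
    simp [ha i j]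

/-- The Euclidean space `𝓢ⁿ` of symmetric `n × n` real matrices. -/
abbrev SymMat (n : ℕ) : Type := ↥(symSubmodule n)

/-- The underlying matrix of an element of `𝓢ⁿ`. -/
def SymMat.mat {n : ℕ} (A : SymMat n) : Matrix (Fin n) (Fin n) ℝ :=
  Matrix.of fun i j => (A : EuclideanSpace ℝ (Fin n × Fin n)) (i, j)

/-- The element of `𝓢ⁿ` given by a symmetric matrix. -/
def SymMat.ofMat {n : ℕ} (M : Matrix (Fin n) (Fin n) ℝ) (hM : M.IsSymm) : SymMat n :=
  ⟨WithLp.toLp 2 fun p => M p.1 p.2, fun i j => by simpa using hM.apply j i⟩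

theorem SymMat.mat_ofMat {n : ℕ} (M : Matrix (Fin n) (Fin n) ℝ) (hM : M.IsSymm) :
    (SymMat.ofMat M hM).mat = M := rfl

theorem SymMat.isHermitian {n : ℕ} (A : SymMat n) : A.mat.IsHermitian := by
  ext i j
  simpa [SymMat.mat, Matrix.conjTranspose_apply] using A.2 j i

theorem SymMat.inner_eq_trace {n : ℕ} (A B : SymMat n) :
    inner ℝ A B = (A.mat * B.mat).trace := by
  rw [Submodule.coe_inner, PiLp.inner_apply, Fintype.sum_prod_type]
  simp only [Matrix.trace, Matrix.diag, Matrix.mul_apply]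
  refine Finset.sum_congr rfl fun i _ => Finset.sum_congr rfl fun j _ => ?_
  simp only [SymMat.mat, Matrix.of_apply]
  rw [B.2 j i]
  simp [mul_comm]

/-- The generalized (Moore–Penrose) inverse `X†` of a symmetric matrix `X = P Diag(λ) Pᵀ`, namely
`P Diag(λ†) Pᵀ` with `λ† = 1/λ` for `λ ≠ 0` and `0† = 0`; see `SymMat.penrose`. -/
def SymMat.pinv {n : ℕ} (X : SymMat n) : Matrix (Fin n) (Fin n) ℝ :=
  X.isHermitian.eigenvectorUnitary.1 *
    Matrix.diagonal (fun i => (X.isHermitian.eigenvalues i)⁻¹) *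
    star X.isHermitian.eigenvectorUnitary.1

/-- The four Penrose equations, which characterize the generalized inverse. -/
theorem SymMat.penrose {n : ℕ} (X : SymMat n) :
    X.mat * X.pinv * X.mat = X.mat ∧ X.pinv * X.mat * X.pinv = X.pinv ∧
      (X.mat * X.pinv).IsSymm ∧ (X.pinv * X.mat).IsSymm := by
  set U : Matrix (Fin n) (Fin n) ℝ := X.isHermitian.eigenvectorUnitary.1 with hU
  set l := X.isHermitian.eigenvalues with hl
  have hUU : star U * U = 1 := Unitary.coe_star_mul_self _
  have hX : X.mat = U * Matrix.diagonal l * star U := by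
    have := X.isHermitian.spectral_theorem
    rw [Unitary.conjStarAlgAut_apply] at this
    exact this
  have hP : X.pinv = U * Matrix.diagonal (fun i => (l i)⁻¹) * star U := rfl
  have key : ∀ D E : Matrix (Fin n) (Fin n) ℝ,
      (U * D * star U) * (U * E * star U) = U * (D * E) * star U := by
    intro D E
    calc (U * D * star U) * (U * E * star U) = U * D * (star U * U) * E * star U := by
          simp only [Matrix.mul_assoc]
      _ = U * (D * E) * star U := by rw [hUU]; simp [Matrix.mul_assoc]
  have sym : ∀ d : Fin n → ℝ, (U * Matrix.diagonal d * star U).IsSymm := by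
    intro d
    have : star U = U.transpose := by
      rw [Matrix.star_eq_conjTranspose, Matrix.conjTranspose_eq_transpose_of_trivial]
    rw [this, Matrix.IsSymm]
    rw [Matrix.transpose_mul, Matrix.transpose_mul, Matrix.transpose_transpose,
      Matrix.diagonal_transpose, Matrix.mul_assoc]
  refine ⟨?_, ?_, ?_, ?_⟩
  · rw [hX, hP, key, key, Matrix.diagonal_mul_diagonal, Matrix.diagonal_mul_diagonal]
    simp
  · rw [hX, hP, key, key, Matrix.diagonal_mul_diagonal, Matrix.diagonal_mul_diagonal]
    have : (fun i => (l i)⁻¹ * l i * (l i)⁻¹) = fun i => (l i)⁻¹ := by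
      funext i
      by_cases hi : l i = 0
      · simp [hi]
      · field_simp
    rw [this]
  · rw [hX, hP, key, Matrix.diagonal_mul_diagonal]
    exact sym _
  · rw [hX, hP, key, Matrix.diagonal_mul_diagonal]
    exact sym _

/-- The positive semidefinite cone `𝓢ⁿ₊`. -/
def psdCone (n : ℕ) : Set (SymMat n) := {A | A.mat.PosSemidef}

/-- The negative semidefinite cone `𝓢ⁿ₋`. -/
def nsdCone (n : ℕ) : Set (SymMat n) := {A | -A ∈ psdCone n}

/-! ### Cones of variational analysis -/

section Cones

variable {E : Type*} [NormedAddCommGroup E] [InnerProductSpace ℝ E]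

/-- The normal cone (in the sense of convex analysis) to a convex set `C` at `x`; it is empty for
`x ∉ C`. -/
def normalCone (C : Set E) (x : E) : Set E :=
  {v | x ∈ C ∧ ∀ x' ∈ C, inner ℝ v (x' - x) ≤ 0}

/-- The Bouligand tangent (contingent) cone to `C` at `x`. -/
def tangentCone (C : Set E) (x : E) : Set E :=
  {d | ∃ (t : ℕ → ℝ) (u : ℕ → E), (∀ k, 0 < t k) ∧ Tendsto t atTop (𝓝 0) ∧
    Tendsto u atTop (𝓝 d) ∧ ∀ k, x + t k • u k ∈ C}

/-- The critical cone `T_C(x) ∩ y^⊥`. -/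
def criticalCone (C : Set E) (x y : E) : Set E :=
  {d | d ∈ tangentCone C x ∧ inner ℝ y d = 0}

end Cones

/-! ### The problem: minimize `f x` subject to `h x = 0`, `G x ∈ 𝓢ⁿ₊` -/

/-- The Euclidean space `𝓨 × 𝓢ⁿ` of multipliers `(y, Γ)`. -/
abbrev Mult (Y : Type*) (n : ℕ) : Type _ := WithLp 2 (Y × SymMat n)

/-- The Euclidean space `𝓧 × 𝓨 × 𝓢ⁿ` of triples. -/
abbrev Triple (X Y : Type*) (n : ℕ) : Type _ := WithLp 2 (X × Mult Y n)

/-- The triple `(x, y, Γ)` as an element of `𝓧 × 𝓨 × 𝓢ⁿ`. -/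
def triple {X Y : Type*} {n : ℕ} (x : X) (y : Y) (Γ : SymMat n) : Triple X Y n :=
  WithLp.toLp 2 (x, WithLp.toLp 2 (y, Γ))

section Problem

variable {X : Type*} [NormedAddCommGroup X] [InnerProductSpace ℝ X] [CompleteSpace X]
  {Y : Type*} [NormedAddCommGroup Y] [InnerProductSpace ℝ Y] [CompleteSpace Y] {n : ℕ}

/-- The Lagrangian `L(x, y, Γ) = f(x) + ⟨y, h(x)⟩ + ⟨Γ, G(x)⟩`. -/
def lagrangian (f : X → ℝ) (h : X → Y) (G : X → SymMat n) (x : X) (y : Y) (Γ : SymMat n) : ℝ :=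
  f x + inner ℝ y (h x) + inner ℝ Γ (G x)

/-- The gradient `∇ₓL(x, y, Γ)`. -/
def gradLagrangian (f : X → ℝ) (h : X → Y) (G : X → SymMat n)
    (x : X) (y : Y) (Γ : SymMat n) : X :=
  gradient (fun x' => lagrangian f h G x' y Γ) x

/-- The Hessian `∇²ₓₓL(x, y, Γ)`, a linear operator on `𝓧`. -/
def hessLagrangian (f : X → ℝ) (h : X → Y) (G : X → SymMat n)
    (x : X) (y : Y) (Γ : SymMat n) : X →L[ℝ] X :=
  fderiv ℝ (fun x' => gradLagrangian f h G x' y Γ) x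

/-- The KKT solution map `S_KKT(a₁, a₂, b)` of the perturbed problem: minimize `f x - ⟨a₁, x⟩`
subject to `h x - a₂ = 0`, `G x - b ∈ 𝓢ⁿ₊`. -/
def kktSol (f : X → ℝ) (h : X → Y) (G : X → SymMat n)
    (a₁ : X) (a₂ : Y) (b : SymMat n) : Set (Triple X Y n) :=
  {z | ∃ (x : X) (y : Y) (Γ : SymMat n), z = triple x y Γ ∧
    gradLagrangian f h G x y Γ - a₁ = 0 ∧ h x - a₂ = 0 ∧
    G x - b ∈ psdCone n ∧ inner ℝ (G x - b) Γ = 0 ∧ Γ ∈ nsdCone n}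

/-- The set `𝓜(x)` of multipliers `(y, Γ)` such that `(x, y, Γ) ∈ S_KKT(0, 0, 0)`. -/
def multipliers (f : X → ℝ) (h : X → Y) (G : X → SymMat n) (x : X) : Set (Mult Y n) :=
  {l | triple x l.fst l.snd ∈ kktSol f h G 0 0 0}

/-- `x` is a stationary point of the unperturbed problem. -/
def IsStationary (f : X → ℝ) (h : X → Y) (G : X → SymMat n) (x : X) : Prop :=
  ∃ (y : Y) (Γ : SymMat n), triple x y Γ ∈ kktSol f h G 0 0 0

/-- The critical cone of the problem at `x` (for the multiplier component `Γ`). -/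
def problemCriticalCone (h : X → Y) (G : X → SymMat n) (x : X) (Γ : SymMat n) : Set X :=
  {d | fderiv ℝ h x d = 0 ∧ fderiv ℝ G x d ∈ criticalCone (psdCone n) (G x) Γ}

/-- The σ-term `Υ_A(Γ, D) = 2⟨Γ, D A† D⟩` (Frobenius inner product). -/
def sigmaTerm (A Γ D : SymMat n) : ℝ :=
  2 * (Γ.mat * (D.mat * A.pinv * D.mat)).trace

/-- The second order sufficient condition at `(x, y, Γ)`. -/
def SOSC (f : X → ℝ) (h : X → Y) (G : X → SymMat n) (x : X) (y : Y) (Γ : SymMat n) : Prop :=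
  ∀ d ∈ problemCriticalCone h G x Γ, d ≠ 0 →
    0 < inner ℝ (hessLagrangian f h G x y Γ d) d - sigmaTerm (G x) Γ (fderiv ℝ G x d)

/-- `𝓖₁(x)`: the `(y, Γ)` with `∇f(x) + ∇h(x)* y + ∇G(x)* Γ = 0`. -/
def multG1 (f : X → ℝ) (h : X → Y) (G : X → SymMat n) (x : X) : Set (Mult Y n) :=
  {l | gradient f x + ContinuousLinearMap.adjoint (fderiv ℝ h x) l.fst +
    ContinuousLinearMap.adjoint (fderiv ℝ G x) l.snd = 0}

/-- `𝓖₂(x)`: the `(y, Γ)` with `Γ ∈ N_{𝓢ⁿ₊}(G(x))`. -/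
def multG2 (Y : Type*) (G : X → SymMat n) (x : X) : Set (Mult Y n) :=
  {l | l.snd ∈ normalCone (psdCone n) (G x)}

end Problem

end NLSDP

end

/-! The estimate splits into a bound for the multipliers in terms of the displacement `x - xbar` and
the perturbation, and a bound for the displacement alone.

Multipliers (`exists_multiplier_near`): the multiplier set is the intersection of the affine set G₁
and the convex set G₂. Compressing Γ to the kernel of `G xbar` produces a nearby normal vector
(`exists_normalCone_near`), hence a point of G₂ whose residual in the equation defining G₁ is O(‖x -
xbar‖ + ‖a₁‖ + ‖b‖). Since G₁ meets ri G₂, the two sets are linearly regular on bounded regions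
(`exists_mem_of_residual`), so the residual controls the distance to an exact multiplier.

Displacement (`exists_primal_bound`): otherwise there are solutions at distances t → 0 with
perturbations o(t) and unit directions e → d. Let (y', Γ') be multipliers at `xbar` within O(t) of
(y, Γ), and write G(x) - b = A + tH with A = G(`xbar`). Subtracting the two stationarity equations,
dividing by t and pairing with e leaves the Hessian form plus t⁻¹⟨Γ - Γ', H⟩, up to o(1). By
complementarity the last term equals -t⁻²(⟨Γ, A⟩ + ⟨Γ', A + tH⟩). Each pairing contributes one half
of the σ-term: the first exactly (`inner_eq_sq_mul_of_complementary`), the second as an upper bound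
up to O(t³) (`inner_le_of_complementary`). In the limit d is a critical direction along which SOSC
fails. -/

namespace NLSDP

/-! ### Positive semidefinite matrices and the trace -/

section MatrixLemmas

variable {n : ℕ}

open scoped MatrixOrder Matrix.Norms.L2Operator in
theorem posSemidef_eq_transpose_mul_self {M : Matrix (Fin n) (Fin n) ℝ} (hM : M.PosSemidef) :
    ∃ B : Matrix (Fin n) (Fin n) ℝ, M = B.transpose * B := by
  obtain ⟨B, hB⟩ := CStarAlgebra.nonneg_iff_eq_star_mul_self.mp hM.nonneg
  refine ⟨B, ?_⟩
  rw [hB, Matrix.star_eq_conjTranspose, Matrix.conjTranspose_eq_transpose_of_trivial]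

/-- Cyclicity of the trace. The right side is the squared Frobenius norm of B Cᵀ, so the pairing of
two positive semidefinite matrices is nonnegative and vanishes only if B Cᵀ = 0. -/
theorem trace_gram_mul_gram (B C : Matrix (Fin n) (Fin n) ℝ) :
    (B.transpose * B * (C.transpose * C)).trace =
      ((B * C.transpose).transpose * (B * C.transpose)).trace := by
  rw [Matrix.transpose_mul, Matrix.transpose_transpose, Matrix.mul_assoc,
    Matrix.trace_mul_comm B.transpose, Matrix.trace_mul_comm (C * B.transpose)]
  simp only [Matrix.mul_assoc]

theorem trace_mul_nonneg_of_posSemidef {M N : Matrix (Fin n) (Fin n) ℝ} (hM : M.PosSemidef)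
    (hN : N.PosSemidef) : 0 ≤ (M * N).trace := by
  obtain ⟨B, rfl⟩ := posSemidef_eq_transpose_mul_self hM
  obtain ⟨C, rfl⟩ := posSemidef_eq_transpose_mul_self hN
  rw [trace_gram_mul_gram]
  have := (Matrix.posSemidef_conjTranspose_mul_self (B * C.transpose)).trace_nonneg
  rwa [Matrix.conjTranspose_eq_transpose_of_trivial] at this

theorem mul_eq_zero_of_trace_mul_eq_zero {M N : Matrix (Fin n) (Fin n) ℝ} (hM : M.PosSemidef)
    (hN : N.PosSemidef) (h : (M * N).trace = 0) : M * N = 0 := by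
  obtain ⟨B, rfl⟩ := posSemidef_eq_transpose_mul_self hM
  obtain ⟨C, rfl⟩ := posSemidef_eq_transpose_mul_self hN
  rw [trace_gram_mul_gram, ← Matrix.conjTranspose_eq_transpose_of_trivial (B * _),
    Matrix.trace_conjTranspose_mul_self_eq_zero_iff] at h
  calc B.transpose * B * (C.transpose * C) = B.transpose * (B * C.transpose) * C := by
        simp only [Matrix.mul_assoc]
    _ = 0 := by rw [h]; simp

end MatrixLemmas

/-! ### Arithmetic, norm and pseudo-inverse of symmetric matrices -/

namespace SymMat

variable {n : ℕ}

theorem mat_add (A B : SymMat n) : (A + B).mat = A.mat + B.mat := rfl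

theorem mat_sub (A B : SymMat n) : (A - B).mat = A.mat - B.mat := rfl

theorem mat_neg (A : SymMat n) : (-A).mat = -A.mat := rfl

theorem mat_smul (c : ℝ) (A : SymMat n) : (c • A).mat = c • A.mat := rfl

theorem mat_zero : (0 : SymMat n).mat = 0 := rfl

theorem mat_transpose (A : SymMat n) : A.mat.transpose = A.mat := by
  have := A.isHermitian
  rwa [Matrix.IsHermitian, Matrix.conjTranspose_eq_transpose_of_trivial] at this

theorem continuous_mat : Continuous (SymMat.mat : SymMat n → Matrix (Fin n) (Fin n) ℝ) := by
  refine continuous_matrix fun i j => ?_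
  change Continuous fun A : SymMat n => (A : EuclideanSpace ℝ (Fin n × Fin n)) (i, j)
  fun_prop

theorem inner_smul_right (c : ℝ) (A B : SymMat n) : inner ℝ A (c • B) = c * inner ℝ A B :=
  real_inner_smul_right A B c

theorem inner_smul_left (c : ℝ) (A B : SymMat n) : inner ℝ (c • A) B = c * inner ℝ A B :=
  real_inner_smul_left A B c

open scoped Matrix.Norms.Frobenius in
theorem norm_mat (A : SymMat n) : ‖A.mat‖ = ‖A‖ := by
  rw [Matrix.frobenius_norm_def, Submodule.coe_norm, EuclideanSpace.norm_eq,
    Fintype.sum_prod_type, Real.sqrt_eq_rpow]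
  simp [SymMat.mat]

/-- The pseudo-inverse is a symmetric matrix commuting with the original one. -/
theorem pinv_transpose_and_comm (X : SymMat n) :
    X.pinv.transpose = X.pinv ∧ X.mat * X.pinv = X.pinv * X.mat := by
  set U : Matrix (Fin n) (Fin n) ℝ := X.isHermitian.eigenvectorUnitary.1 with hU
  set l := X.isHermitian.eigenvalues with hl
  have hUU : star U * U = 1 := Unitary.coe_star_mul_self _
  have hX : X.mat = U * Matrix.diagonal l * star U := by
    have := X.isHermitian.spectral_theorem
    rw [Unitary.conjStarAlgAut_apply] at this
    exact this
  have hP : X.pinv = U * Matrix.diagonal (fun i => (l i)⁻¹) * star U := rfl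
  have key : ∀ D E : Matrix (Fin n) (Fin n) ℝ,
      (U * D * star U) * (U * E * star U) = U * (D * E) * star U := by
    intro D E
    calc (U * D * star U) * (U * E * star U) = U * D * (star U * U) * E * star U := by
          simp only [Matrix.mul_assoc]
      _ = U * (D * E) * star U := by rw [hUU]; simp [Matrix.mul_assoc]
  constructor
  · have : star U = U.transpose := by
      rw [Matrix.star_eq_conjTranspose, Matrix.conjTranspose_eq_transpose_of_trivial]
    rw [hP, this, Matrix.transpose_mul, Matrix.transpose_mul, Matrix.transpose_transpose,
      Matrix.diagonal_transpose, Matrix.mul_assoc]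
  · rw [hX, hP, key, key, Matrix.diagonal_mul_diagonal, Matrix.diagonal_mul_diagonal]
    simp only [mul_comm]

theorem mul_mul_transpose_isSymm (P : Matrix (Fin n) (Fin n) ℝ) (Γ : SymMat n) :
    (P * Γ.mat * P.transpose).IsSymm := by
  rw [Matrix.IsSymm, Matrix.transpose_mul, Matrix.transpose_mul, Matrix.transpose_transpose,
    mat_transpose, Matrix.mul_assoc]

end SymMat

/-! ### Normal cone of the positive semidefinite cone -/

section NormalCone

variable {n : ℕ}

theorem inner_nonpos_of_mem_nsdCone {A Γ : SymMat n} (hA : A ∈ psdCone n) (hΓ : Γ ∈ nsdCone n) :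
    inner ℝ Γ A ≤ 0 := by
  have := trace_mul_nonneg_of_posSemidef hΓ hA
  rw [← SymMat.inner_eq_trace, inner_neg_left] at this
  linarith

theorem mat_mul_mat_eq_zero {A Γ : SymMat n} (hA : A ∈ psdCone n) (hΓ : Γ ∈ nsdCone n)
    (h : inner ℝ Γ A = 0) : Γ.mat * A.mat = 0 := by
  have := mul_eq_zero_of_trace_mul_eq_zero (M := (-Γ).mat) (N := A.mat) hΓ hA
    (by rw [← SymMat.inner_eq_trace, inner_neg_left, h, neg_zero])
  rwa [SymMat.mat_neg, Matrix.neg_mul, neg_eq_zero] at this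

theorem mat_mul_mat_eq_zero' {A Γ : SymMat n} (h : Γ.mat * A.mat = 0) : A.mat * Γ.mat = 0 := by
  have := congrArg Matrix.transpose h
  rwa [Matrix.transpose_mul, SymMat.mat_transpose, SymMat.mat_transpose,
    Matrix.transpose_zero] at this

/-- Testing the normal inequality at 0 and 2A forces orthogonality; testing it at A + v vᵀ forces
negative semidefiniteness. -/
theorem mem_normalCone_psdCone {A Γ : SymMat n} :
    Γ ∈ normalCone (psdCone n) A ↔ A ∈ psdCone n ∧ Γ ∈ nsdCone n ∧ inner ℝ Γ A = 0 := by
  constructor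
  · rintro ⟨hA, h⟩
    have hzero : (0 : SymMat n) ∈ psdCone n := by
      change (0 : SymMat n).mat.PosSemidef
      rw [SymMat.mat_zero]
      exact Matrix.PosSemidef.zero
    have hadd : ∀ B ∈ psdCone n, A + B ∈ psdCone n := fun B hB => Matrix.PosSemidef.add hA hB
    have h1 := h 0 hzero
    have h2 := h _ (hadd A hA)
    rw [zero_sub, inner_neg_right] at h1
    rw [add_sub_cancel_left] at h2
    refine ⟨hA, ?_, le_antisymm h2 (by linarith)⟩
    refine Matrix.PosSemidef.of_dotProduct_mulVec_nonneg (SymMat.isHermitian _) fun v => ?_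
    have hsym : (Matrix.vecMulVec v v).IsSymm := by
      ext i j
      simp [Matrix.vecMulVec_apply, mul_comm]
    have hpsd : SymMat.ofMat _ hsym ∈ psdCone n := by
      change (SymMat.ofMat _ hsym).mat.PosSemidef
      rw [SymMat.mat_ofMat]
      simpa using Matrix.posSemidef_vecMulVec_self_star v
    have h3 := h _ (hadd _ hpsd)
    rw [add_sub_cancel_left, SymMat.inner_eq_trace, SymMat.mat_ofMat, Matrix.mul_vecMulVec,
      Matrix.trace_vecMulVec, dotProduct_comm] at h3
    rw [SymMat.mat_neg, Matrix.neg_mulVec, dotProduct_neg]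
    simpa using h3
  · rintro ⟨hA, hΓ, h0⟩
    refine ⟨hA, fun B hB => ?_⟩
    rw [inner_sub_right, h0, sub_zero]
    exact inner_nonpos_of_mem_nsdCone hB hΓ

theorem convex_normalCone {E : Type*} [NormedAddCommGroup E] [InnerProductSpace ℝ E]
    (C : Set E) (x : E) : Convex ℝ (normalCone C x) := by
  rintro u ⟨hx, hu⟩ v ⟨-, hv⟩ a b ha hb -
  refine ⟨hx, fun x' hx' => ?_⟩
  rw [inner_add_left, real_inner_smul_left, real_inner_smul_left]
  have h1 := mul_nonpos_of_nonneg_of_nonpos ha (hu x' hx')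
  have h2 := mul_nonpos_of_nonneg_of_nonpos hb (hv x' hx')
  linarith

open scoped Matrix.Norms.Frobenius in
/-- Upper Lipschitz behaviour of the normal cone mapping of the positive semidefinite cone. -/
theorem exists_normalCone_near {A : SymMat n} (hA : A ∈ psdCone n) :
    ∃ C : ℝ, 0 < C ∧ ∀ B ∈ psdCone n, ∀ Γ ∈ nsdCone n, inner ℝ Γ B = 0 →
      ∃ Γ' ∈ normalCone (psdCone n) A, ‖Γ - Γ'‖ ≤ C * (‖Γ‖ * ‖B - A‖) := by
  obtain ⟨hpen, -, -, -⟩ := A.penrose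
  obtain ⟨hsym, hcomm⟩ := A.pinv_transpose_and_comm
  -- Q and P are the orthogonal projections onto the range and the kernel of A. The witness is P Γ
  -- P, which A annihilates.
  set Q : Matrix (Fin n) (Fin n) ℝ := A.mat * A.pinv with hQ
  set P : Matrix (Fin n) (Fin n) ℝ := 1 - Q with hP
  have hQT : Q.transpose = Q := by
    rw [hQ, Matrix.transpose_mul, hsym, SymMat.mat_transpose, ← hcomm]
  have hPT : P.transpose = P := by rw [hP, Matrix.transpose_sub, hQT, Matrix.transpose_one]
  have hPA : P * A.mat = 0 := by rw [hP, Matrix.sub_mul, hpen, Matrix.one_mul, sub_self]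
  refine ⟨‖A.pinv‖ + ‖P‖ * ‖A.pinv‖ + 1, by positivity, fun B hB Γ hΓ h0 => ?_⟩
  have hΓB := mat_mul_mat_eq_zero hB hΓ h0
  have hBΓ := mat_mul_mat_eq_zero' hΓB
  refine ⟨SymMat.ofMat (P * Γ.mat * P.transpose) (SymMat.mul_mul_transpose_isSymm P Γ), ?_, ?_⟩
  · refine mem_normalCone_psdCone.2 ⟨hA, ?_, ?_⟩
    · change (-SymMat.ofMat _ _).mat.PosSemidef
      rw [SymMat.mat_neg, SymMat.mat_ofMat]
      have := Matrix.PosSemidef.mul_mul_conjTranspose_same (show (-Γ).mat.PosSemidef from hΓ) P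
      rw [Matrix.conjTranspose_eq_transpose_of_trivial, SymMat.mat_neg, Matrix.mul_neg,
        Matrix.neg_mul] at this
      exact this
    · rw [SymMat.inner_eq_trace, SymMat.mat_ofMat, hPT, Matrix.mul_assoc, hPA]
      simp
  · rw [← SymMat.norm_mat, SymMat.mat_sub, SymMat.mat_ofMat, hPT]
    -- Since BΓ = 0, the product AΓ equals -(B - A)Γ, so the part of Γ removed by the compression is
    -- linear in B - A.
    have hQΓ : Q * Γ.mat = -(A.pinv * ((B - A).mat * Γ.mat)) := by
      rw [hcomm, SymMat.mat_sub, Matrix.sub_mul, hBΓ, zero_sub, Matrix.mul_neg, neg_neg,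
        Matrix.mul_assoc]
    have hΓQ : Γ.mat * Q = -(Γ.mat * (B - A).mat * A.pinv) := by
      rw [hQ, SymMat.mat_sub, Matrix.mul_sub, hΓB, zero_sub, Matrix.neg_mul, neg_neg,
        Matrix.mul_assoc]
    have hdec : Γ.mat - P * Γ.mat * P = Q * Γ.mat + P * (Γ.mat * Q) := by
      rw [hP]; noncomm_ring
    rw [hdec, hQΓ, hΓQ]
    have e1 : ‖A.pinv * ((B - A).mat * Γ.mat)‖ ≤ ‖A.pinv‖ * (‖B - A‖ * ‖Γ‖) := by
      rw [← SymMat.norm_mat (B - A), ← SymMat.norm_mat Γ]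
      exact (norm_mul_le _ _).trans (by gcongr; exact norm_mul_le _ _)
    have e2 : ‖P * (Γ.mat * (B - A).mat * A.pinv)‖ ≤ ‖P‖ * (‖Γ‖ * ‖B - A‖ * ‖A.pinv‖) := by
      rw [← SymMat.norm_mat (B - A), ← SymMat.norm_mat Γ]
      refine (norm_mul_le _ _).trans ?_
      gcongr
      refine (norm_mul_le _ _).trans ?_
      gcongr
      exact norm_mul_le _ _
    have e3 : 0 ≤ ‖Γ‖ * ‖B - A‖ := by positivity
    calc _ ≤ ‖A.pinv * ((B - A).mat * Γ.mat)‖ + ‖P * (Γ.mat * (B - A).mat * A.pinv)‖ := by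
          refine (norm_add_le _ _).trans ?_
          rw [norm_neg, Matrix.mul_neg, norm_neg]
      _ ≤ _ := by nlinarith

/-! ### Second order expansions along the positive semidefinite cone -/

/-- An exact expansion: if `Γ` is complementary to `A + t H`, the pairing of `Γ` with `A` is of
second order in `t`. -/
theorem inner_eq_sq_mul_of_complementary {A Γ H : SymMat n} {t : ℝ}
    (h : Γ.mat * (A + t • H).mat = 0) :
    inner ℝ Γ A = t ^ 2 * (Γ.mat * (H.mat * A.pinv * H.mat)).trace := by
  obtain ⟨hpen, -, -, -⟩ := A.penrose
  have h1 : Γ.mat * A.mat = -(t • (Γ.mat * H.mat)) := by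
    rw [SymMat.mat_add, SymMat.mat_smul, Matrix.mul_add, Matrix.mul_smul] at h
    exact eq_neg_of_add_eq_zero_left h
  have h2 : A.mat * Γ.mat = -(t • (H.mat * Γ.mat)) := by
    have := congrArg Matrix.transpose h1
    simpa [Matrix.transpose_mul, SymMat.mat_transpose] using this
  rw [SymMat.inner_eq_trace]
  -- Writing A = A A† A makes A occur on both sides of Γ. Complementarity trades each occurrence for
  -- -tH, whence the factor t².
  calc (Γ.mat * A.mat).trace = (Γ.mat * A.mat * A.pinv * A.mat).trace := by
        rw [Matrix.mul_assoc, Matrix.mul_assoc, ← Matrix.mul_assoc A.mat, hpen]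
    _ = (A.mat * (Γ.mat * A.mat) * A.pinv).trace := by
        rw [Matrix.trace_mul_comm]; simp only [Matrix.mul_assoc]
    _ = (-(t • (A.mat * Γ.mat * H.mat * A.pinv))).trace := by
        rw [h1]; simp [Matrix.mul_assoc]
    _ = t ^ 2 * (H.mat * (Γ.mat * H.mat * A.pinv)).trace := by
        rw [h2]; simp [Matrix.mul_assoc, pow_two, smul_smul]
    _ = _ := by
        rw [Matrix.trace_mul_comm]; simp only [Matrix.mul_assoc]

/-- The congruence of A + tH by 1 - tHA† is positive semidefinite, so its pairing with Γ is
nonpositive. Expanding with ΓA = AΓ = 0 and A†AA† = A† leaves ⟨Γ, A + tH⟩, the quadratic term with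
net coefficient -t² = t² - 2t², and the cubic remainder. -/
theorem inner_le_of_complementary {A Γ H : SymMat n} {t : ℝ} (hΓ : Γ ∈ nsdCone n)
    (h : Γ.mat * A.mat = 0) (hX : A + t • H ∈ psdCone n) :
    inner ℝ Γ (A + t • H) ≤ t ^ 2 * (Γ.mat * (H.mat * A.pinv * H.mat)).trace -
      t ^ 3 * (Γ.mat * (H.mat * A.pinv * H.mat * A.pinv * H.mat)).trace := by
  obtain ⟨hpen, hpen2, -, -⟩ := A.penrose
  obtain ⟨hsym, hcomm⟩ := A.pinv_transpose_and_comm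
  have h' := mat_mul_mat_eq_zero' h
  set J := A.pinv with hJ
  have hpsd := Matrix.PosSemidef.mul_mul_conjTranspose_same
    (show (A + t • H).mat.PosSemidef from hX) (1 - t • (H.mat * J))
  have htr := trace_mul_nonneg_of_posSemidef (show (-Γ).mat.PosSemidef from hΓ) hpsd
  rw [Matrix.conjTranspose_eq_transpose_of_trivial, Matrix.transpose_sub, Matrix.transpose_smul,
    Matrix.transpose_mul, Matrix.transpose_one, hsym, SymMat.mat_transpose, SymMat.mat_neg,
    Matrix.neg_mul, Matrix.trace_neg, SymMat.mat_add, SymMat.mat_smul] at htr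
  have expand : Γ.mat * ((1 - t • (H.mat * J)) * (A.mat + t • H.mat) * (1 - t • (J * H.mat))) =
      Γ.mat * (A.mat + t • H.mat) - t • (Γ.mat * H.mat * (J * A.mat))
        - t • (Γ.mat * A.mat * J * H.mat)
        + t ^ 2 • (Γ.mat * (H.mat * (J * A.mat * J) * H.mat))
        - (2 * t ^ 2) • (Γ.mat * (H.mat * J * H.mat))
        + t ^ 3 • (Γ.mat * (H.mat * J * H.mat * J * H.mat)) := by
    simp only [Matrix.mul_add, Matrix.add_mul, Matrix.mul_sub, Matrix.sub_mul, Matrix.mul_one,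
      Matrix.one_mul, Matrix.smul_mul, Matrix.mul_smul, Matrix.mul_assoc]
    module
  have hz : (Γ.mat * H.mat * (J * A.mat)).trace = 0 := by
    rw [Matrix.trace_mul_comm, ← hcomm, hcomm, Matrix.mul_assoc, ← Matrix.mul_assoc A.mat, h']
    simp
  rw [expand, h, hpen2] at htr
  simp only [Matrix.trace_add, Matrix.trace_sub, Matrix.trace_smul, hz, smul_eq_mul, mul_zero,
    Matrix.zero_mul, Matrix.trace_zero] at htr
  rw [SymMat.inner_eq_trace, SymMat.mat_add, SymMat.mat_smul, Matrix.mul_add, Matrix.trace_add]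
  simp only [Matrix.mul_add, Matrix.trace_add] at htr
  linarith

end NormalCone

/-! ### Linear regularity of an affine subspace and a convex set -/

section Regularity

variable {E F : Type*} [NormedAddCommGroup E] [NormedSpace ℝ E] [FiniteDimensional ℝ E]
  [NormedAddCommGroup F] [NormedSpace ℝ F]

/-- A linear map on a finite-dimensional space has solutions of size proportional to the
right-hand side, within any given subspace. -/
theorem exists_bounded_preimage (T : E →ₗ[ℝ] F) (W : Submodule ℝ E) :
    ∃ C : ℝ, 0 < C ∧ ∀ w ∈ W, ∃ u ∈ W, T u = T w ∧ ‖u‖ ≤ C * ‖T w‖ := by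
  set S : W →ₗ[ℝ] F := T.comp W.subtype with hS
  obtain ⟨g, hg⟩ := S.rangeRestrict.exists_rightInverse_of_surjective S.range_rangeRestrict
  refine ⟨‖LinearMap.toContinuousLinearMap g‖ + 1, by positivity, fun w hw => ?_⟩
  set r : LinearMap.range S := S.rangeRestrict ⟨w, hw⟩ with hr
  have hSg : S (g r) = T w := congrArg Subtype.val (LinearMap.congr_fun hg r)
  refine ⟨(g r : E), (g r).2, hSg, ?_⟩
  have h1 : ‖g r‖ ≤ ‖LinearMap.toContinuousLinearMap g‖ * ‖r‖ :=
    (LinearMap.toContinuousLinearMap g).le_opNorm r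
  have h2 : ‖r‖ = ‖T w‖ := rfl
  rw [h2] at h1
  change ‖g r‖ ≤ _
  nlinarith [norm_nonneg (T w)]

/-- If the affine subspace `T l = c` meets the relative interior of the convex set `S`, then the
distance from points of `S` in a bounded region to the intersection is bounded by the residual. -/
theorem exists_mem_of_residual (T : E →ₗ[ℝ] F) (c : F) {S : Set E} (hS : Convex ℝ S) {v : E}
    (hv : v ∈ intrinsicInterior ℝ S) (hTv : T v = c) (R : ℝ) :
    ∃ K : ℝ, 0 < K ∧ ∀ l ∈ S, ‖l‖ ≤ R → ∃ m ∈ S, T m = c ∧ ‖l - m‖ ≤ K * ‖T l - c‖ := by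
  have hvS : v ∈ S := intrinsicInterior_subset hv
  obtain ⟨v', hv', rfl⟩ := mem_intrinsicInterior.1 hv
  set v : E := (v' : E) with hvdef
  obtain ⟨ε, hε, hball⟩ := Metric.nhds_basis_closedBall.mem_iff.1 (mem_interior_iff_mem_nhds.1 hv')
  obtain ⟨C, hC, hpre⟩ := exists_bounded_preimage T (affineSpan ℝ S).direction
  refine ⟨C * (‖v‖ + |R|) / ε + C, by positivity, fun l hl hlR => ?_⟩
  have hlv : l - v ∈ (affineSpan ℝ S).direction :=
    AffineSubspace.vsub_mem_direction (subset_affineSpan ℝ S hl) v'.2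
  obtain ⟨u, hu, hTu, hun⟩ := hpre _ hlv
  rw [map_sub, hTv] at hTu hun
  -- An upper bound for ‖u‖, so that `(ε / s) • u` has norm at most ε. A zero residual is treated
  -- separately because of the division by s.
  set s := C * ‖T l - c‖ with hs
  by_cases hs0 : T l - c = 0
  · exact ⟨l, hl, sub_eq_zero.1 hs0, by simp [hs0]⟩
  have hspos : 0 < s := mul_pos hC (norm_pos_iff.2 hs0)
  have hmem : v - (ε / s) • u ∈ S := by
    have hspan : v - (ε / s) • u ∈ affineSpan ℝ S := by
      have := AffineSubspace.vadd_mem_of_mem_direction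
        (Submodule.smul_mem _ (-(ε / s)) hu) v'.2
      rw [vadd_eq_add] at this
      convert this using 1
      rw [neg_smul]; abel
    have : (⟨_, hspan⟩ : affineSpan ℝ S) ∈ Metric.closedBall v' ε := by
      rw [Metric.mem_closedBall, Subtype.dist_eq, dist_eq_norm]
      rw [sub_sub_cancel_left, norm_neg, norm_smul, Real.norm_of_nonneg (by positivity)]
      rw [div_mul_eq_mul_div, div_le_iff₀ hspos]
      gcongr
    exact hball this
  -- This weight satisfies θ ε / s = 1 - θ, so the residual of l, weighted by 1 - θ, is cancelled
  -- exactly by the step from v along -u. As θ ≤ s / ε, the combination stays within O(s) of l.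
  set θ := s / (s + ε) with hθ
  have hθ0 : 0 ≤ θ := by positivity
  have hθ1 : 1 - θ = ε / (s + ε) := by rw [hθ]; field_simp; ring
  have hθu : θ * (ε / s) = 1 - θ := by rw [hθ1, hθ]; field_simp
  refine ⟨(1 - θ) • l + θ • (v - (ε / s) • u), hS hl hmem (by rw [hθ1]; positivity) hθ0
    (by ring), ?_, ?_⟩
  · rw [smul_sub, smul_smul, hθu, map_add, map_sub, map_smul, map_smul, map_smul, hTv, hTu]
    module
  · have e : l - ((1 - θ) • l + θ • (v - (ε / s) • u)) = θ • (l - v) + (1 - θ) • u := by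
      rw [smul_sub, smul_smul, hθu]; module
    rw [e]
    have hθle : θ ≤ s / ε := by
      rw [hθ]; gcongr; linarith
    have hlvn : ‖l - v‖ ≤ ‖v‖ + |R| := by
      refine (norm_sub_le _ _).trans ?_
      linarith [le_abs_self R]
    calc ‖θ • (l - v) + (1 - θ) • u‖ ≤ θ * ‖l - v‖ + (1 - θ) * ‖u‖ := by
          refine (norm_add_le _ _).trans ?_
          rw [norm_smul, norm_smul, Real.norm_of_nonneg hθ0,
            Real.norm_of_nonneg (by rw [hθ1]; positivity)]
      _ ≤ s / ε * (‖v‖ + |R|) + 1 * s := by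
          gcongr
          linarith
      _ = _ := by rw [hs]; field_simp

end Regularity

/-! ### Norm comparisons in Euclidean products -/

section ProductNorm

variable {E F : Type*} [NormedAddCommGroup E] [NormedAddCommGroup F]

theorem norm_toLp_le (u : E) (v : F) :
    ‖(WithLp.toLp 2 (u, v) : WithLp 2 (E × F))‖ ≤ ‖u‖ + ‖v‖ := by
  rw [WithLp.prod_norm_eq_of_L2]
  refine Real.sqrt_le_iff.2 ⟨by positivity, ?_⟩
  have : 0 ≤ ‖u‖ * ‖v‖ := by positivity
  change ‖u‖ ^ 2 + ‖v‖ ^ 2 ≤ _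
  nlinarith

theorem norm_fst_le (z : WithLp 2 (E × F)) : ‖z.fst‖ ≤ ‖z‖ := by
  rw [WithLp.prod_norm_eq_of_L2]
  exact Real.le_sqrt_of_sq_le (by nlinarith [sq_nonneg ‖z.snd‖])

theorem norm_snd_le (z : WithLp 2 (E × F)) : ‖z.snd‖ ≤ ‖z‖ := by
  rw [WithLp.prod_norm_eq_of_L2]
  exact Real.le_sqrt_of_sq_le (by nlinarith [sq_nonneg ‖z.fst‖])

end ProductNorm

/-! ### The Lagrangian and its derivatives -/

theorem exists_local_lipschitz {E F : Type*} [NormedAddCommGroup E] [NormedSpace ℝ E]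
    [NormedAddCommGroup F] [NormedSpace ℝ F] {g : E → F} {x₀ : E} (hg : DifferentiableAt ℝ g x₀) :
    ∃ K : ℝ, 0 < K ∧ ∃ r : ℝ, 0 < r ∧ ∀ x, ‖x - x₀‖ < r → ‖g x - g x₀‖ ≤ K * ‖x - x₀‖ := by
  obtain ⟨K, hK, hbound⟩ := hg.isBigO_sub.exists_pos
  obtain ⟨r, hr, hball⟩ := Metric.eventually_nhds_iff.1 hbound.bound
  exact ⟨K, hK, r, hr, fun x hx => hball (by rwa [dist_eq_norm])⟩

theorem norm_adjoint_apply_sub_le {E F : Type*} [NormedAddCommGroup E] [InnerProductSpace ℝ E]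
    [CompleteSpace E] [NormedAddCommGroup F] [InnerProductSpace ℝ F] [CompleteSpace F]
    (S T : E →L[ℝ] F) (v : F) :
    ‖ContinuousLinearMap.adjoint S v - ContinuousLinearMap.adjoint T v‖ ≤ ‖S - T‖ * ‖v‖ := by
  rw [← sub_apply, ← map_sub]
  refine (ContinuousLinearMap.le_opNorm _ _).trans ?_
  rw [LinearIsometryEquiv.norm_map]

section Basic

variable {X : Type*} [NormedAddCommGroup X] [InnerProductSpace ℝ X]
  {Y : Type*} [NormedAddCommGroup Y] [InnerProductSpace ℝ Y] {n : ℕ}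

theorem contDiff_lagrangian {f : X → ℝ} {h : X → Y} {G : X → SymMat n} (hf : ContDiff ℝ 2 f)
    (hh : ContDiff ℝ 2 h) (hG : ContDiff ℝ 2 G) (y : Y) (Γ : SymMat n) :
    ContDiff ℝ 2 fun x => lagrangian f h G x y Γ :=
  (hf.add (contDiff_const.inner ℝ hh)).add (contDiff_const.inner ℝ hG)

theorem convex_multG2 {Z : Type*} (G : Z → SymMat n) (x : Z) : Convex ℝ (multG2 Y G x) :=
  fun _ hl _ hm _ _ ha hb hab => convex_normalCone _ _ hl hm ha hb hab

variable [CompleteSpace X]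

theorem differentiable_gradient {g : X → ℝ} (hg : ContDiff ℝ 2 g) :
    Differentiable ℝ (gradient g) := by
  have h1 : Differentiable ℝ (fderiv ℝ g) :=
    (hg.fderiv_right (m := 1) (by norm_num)).differentiable (by norm_num)
  exact (InnerProductSpace.toDual ℝ X).symm.toContinuousLinearEquiv.differentiable.comp h1

theorem hasFDerivAt_gradLagrangian {f : X → ℝ} {h : X → Y} {G : X → SymMat n}
    (hf : ContDiff ℝ 2 f) (hh : ContDiff ℝ 2 h) (hG : ContDiff ℝ 2 G) (x : X) (y : Y)
    (Γ : SymMat n) :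
    HasFDerivAt (fun x' => gradLagrangian f h G x' y Γ) (hessLagrangian f h G x y Γ) x :=
  (differentiable_gradient (contDiff_lagrangian hf hh hG y Γ) x).hasFDerivAt

theorem mem_kktSol {f : X → ℝ} {h : X → Y} {G : X → SymMat n} {a₁ : X} {a₂ : Y} {b : SymMat n}
    {x : X} {y : Y} {Γ : SymMat n} :
    triple x y Γ ∈ kktSol f h G a₁ a₂ b ↔ gradLagrangian f h G x y Γ - a₁ = 0 ∧ h x - a₂ = 0 ∧
      G x - b ∈ psdCone n ∧ inner ℝ (G x - b) Γ = 0 ∧ Γ ∈ nsdCone n := by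
  constructor
  · rintro ⟨x', y', Γ', hz, hrest⟩
    have hx : x = x' := congrArg (fun z : Triple X Y n => z.fst) hz
    have hy : y = y' := congrArg (fun z : Triple X Y n => z.snd.fst) hz
    have hΓ : Γ = Γ' := congrArg (fun z : Triple X Y n => z.snd.snd) hz
    subst hx hy hΓ
    exact hrest
  · intro hrest
    exact ⟨x, y, Γ, rfl, hrest⟩

theorem mem_multipliers {f : X → ℝ} {h : X → Y} {G : X → SymMat n} {x : X} {l : Mult Y n} :
    l ∈ multipliers f h G x ↔ gradLagrangian f h G x l.fst l.snd = 0 ∧ h x = 0 ∧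
      G x ∈ psdCone n ∧ inner ℝ l.snd (G x) = 0 ∧ l.snd ∈ nsdCone n := by
  change triple x l.fst l.snd ∈ kktSol f h G 0 0 0 ↔ _
  rw [mem_kktSol, sub_zero, sub_zero, sub_zero, real_inner_comm]

end Basic

section Calculus

variable {X : Type*} [NormedAddCommGroup X] [InnerProductSpace ℝ X] [CompleteSpace X]
  {Y : Type*} [NormedAddCommGroup Y] [InnerProductSpace ℝ Y] [CompleteSpace Y] {n : ℕ}

theorem gradLagrangian_eq {f : X → ℝ} {h : X → Y} {G : X → SymMat n} {x : X}
    (hf : DifferentiableAt ℝ f x) (hh : DifferentiableAt ℝ h x) (hG : DifferentiableAt ℝ G x)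
    (y : Y) (Γ : SymMat n) :
    gradLagrangian f h G x y Γ = gradient f x + ContinuousLinearMap.adjoint (fderiv ℝ h x) y +
      ContinuousLinearMap.adjoint (fderiv ℝ G x) Γ := by
  refine HasGradientAt.gradient ?_
  rw [hasGradientAt_iff_hasFDerivAt]
  have h1 := (hf.hasFDerivAt.add ((innerSL ℝ y).hasFDerivAt.comp x hh.hasFDerivAt)).add
    ((innerSL ℝ Γ).hasFDerivAt.comp x hG.hasFDerivAt)
  refine h1.congr_fderiv ?_
  ext v
  simp [gradient, ContinuousLinearMap.adjoint_inner_left]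

set_option maxHeartbeats 1000000 in
/-- Bounded multipliers of perturbed problems are close to the multiplier set, up to the size of
the perturbation and of the displacement of the primal variable. -/
theorem exists_multiplier_near [FiniteDimensional ℝ Y] {f : X → ℝ} {h : X → Y} {G : X → SymMat n}
    (hf : ContDiff ℝ 2 f) (hh : ContDiff ℝ 2 h) (hG : ContDiff ℝ 2 G) {xbar : X}
    (hx : IsStationary f h G xbar)
    (hri : (multG1 f h G xbar ∩ intrinsicInterior ℝ (multG2 Y G xbar)).Nonempty)
    {R : ℝ} (hR : 0 < R) :
    ∃ C : ℝ, 0 < C ∧ ∃ r : ℝ, 0 < r ∧ ∀ (a₁ : X) (a₂ : Y) (b : SymMat n) (x : X) (y : Y)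
      (Γ : SymMat n), triple x y Γ ∈ kktSol f h G a₁ a₂ b → ‖b‖ ≤ 1 → ‖x - xbar‖ < r →
        ‖y‖ ≤ R → ‖Γ‖ ≤ R → ∃ l ∈ multipliers f h G xbar,
          ‖WithLp.toLp 2 (y, Γ) - l‖ ≤ C * (‖x - xbar‖ + ‖a₁‖ + ‖b‖) := by
  obtain ⟨y₀, Γ₀, hz₀⟩ := hx
  obtain ⟨-, hh0, hA, -, -⟩ := mem_kktSol.1 hz₀
  rw [sub_zero] at hh0 hA
  obtain ⟨v, hv1, hv2⟩ := hri
  have hdf := hf.differentiable (by norm_num)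
  have hdh := hh.differentiable (by norm_num)
  have hdG := hG.differentiable (by norm_num)
  have hdh' : Differentiable ℝ (fderiv ℝ h) :=
    (hh.fderiv_right (m := 1) (by norm_num)).differentiable (by norm_num)
  have hdG' : Differentiable ℝ (fderiv ℝ G) :=
    (hG.fderiv_right (m := 1) (by norm_num)).differentiable (by norm_num)
  obtain ⟨K₁, hK₁, r₁, hr₁, hL₁⟩ := exists_local_lipschitz (differentiable_gradient hf xbar)
  obtain ⟨K₂, hK₂, r₂, hr₂, hL₂⟩ := exists_local_lipschitz (hdh' xbar)
  obtain ⟨K₃, hK₃, r₃, hr₃, hL₃⟩ := exists_local_lipschitz (F := X →L[ℝ] SymMat n) (hdG' xbar)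
  obtain ⟨K₄, hK₄, r₄, hr₄, hL₄⟩ := exists_local_lipschitz (hdG xbar)
  obtain ⟨C₁, hC₁, hnear⟩ := exists_normalCone_near hA
  set T : Mult Y n →ₗ[ℝ] X :=
    (ContinuousLinearMap.adjoint (fderiv ℝ h xbar)).toLinearMap ∘ₗ WithLp.fstₗ 2 ℝ Y (SymMat n) +
    (ContinuousLinearMap.adjoint (fderiv ℝ G xbar)).toLinearMap ∘ₗ WithLp.sndₗ 2 ℝ Y (SymMat n)
    with hT
  have hTl : ∀ l : Mult Y n, T l = ContinuousLinearMap.adjoint (fderiv ℝ h xbar) l.fst +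
      ContinuousLinearMap.adjoint (fderiv ℝ G xbar) l.snd := fun l => rfl
  have hgrad : ∀ l : Mult Y n, gradLagrangian f h G xbar l.fst l.snd =
      T l - -gradient f xbar := by
    intro l
    rw [gradLagrangian_eq (hdf _) (hdh _) (hdG _), hTl]
    abel
  have hTv : T v = -gradient f xbar := by
    have : gradient f xbar + _ + _ = 0 := hv1
    rw [add_assoc] at this
    exact eq_neg_of_add_eq_zero_right this
  -- Constant of the normal-cone estimate once ‖Γ‖ ≤ R and `G x - b` is within (K₄ + 1)(‖x - xbar‖ +
  -- ‖b‖) of `G xbar`. Below, ‖x - xbar‖ < 1 and ‖b‖ ≤ 1 make the correction of Γ at most 2C₂, which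
  -- explains the radius passed to `exists_mem_of_residual`.
  set C₂ := C₁ * (R * (K₄ + 1)) with hC₂
  have hC₂pos : 0 < C₂ := by positivity
  set r := min (min r₁ r₂) (min r₃ (min r₄ 1)) with hr
  obtain ⟨K, hK, hres⟩ := exists_mem_of_residual T (-gradient f xbar) (convex_multG2 G xbar) hv2
    hTv (R + (R + C₂ * 2))
  obtain ⟨N, hNnn, hN⟩ : ∃ N : ℝ, 0 ≤ N ∧ ∀ Δ : SymMat n,
      ‖ContinuousLinearMap.adjoint (fderiv ℝ G xbar) Δ‖ ≤ N * ‖Δ‖ :=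
    ⟨_, ContinuousLinearMap.opNorm_nonneg _, ContinuousLinearMap.le_opNorm _⟩
  refine ⟨C₂ + K * (K₁ + K₂ * R + K₃ * R + 1 + N * C₂), by positivity, r, by positivity, ?_⟩
  intro a₁ a₂ b x y Γ hz hb hxr hy hΓ
  obtain ⟨hz1, hz2, hz3, hz4, hz5⟩ := mem_kktSol.1 hz
  rw [real_inner_comm] at hz4
  have hx1 : ‖x - xbar‖ < r₁ := hxr.trans_le ((min_le_left _ _).trans (min_le_left _ _))
  have hx2 : ‖x - xbar‖ < r₂ := hxr.trans_le ((min_le_left _ _).trans (min_le_right _ _))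
  have hx3 : ‖x - xbar‖ < r₃ := hxr.trans_le ((min_le_right _ _).trans (min_le_left _ _))
  have hx4 : ‖x - xbar‖ < r₄ :=
    hxr.trans_le ((min_le_right _ _).trans ((min_le_right _ _).trans (min_le_left _ _)))
  have hx5 : ‖x - xbar‖ < 1 :=
    hxr.trans_le ((min_le_right _ _).trans ((min_le_right _ _).trans (min_le_right _ _)))
  obtain ⟨Γ₂, hΓ₂, hΓΓ₂⟩ := hnear _ hz3 Γ hz5 hz4
  set t := ‖x - xbar‖ with ht
  have ht0 : 0 ≤ t := norm_nonneg _
  have hb0 := norm_nonneg b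
  have ha0 := norm_nonneg a₁
  have hΓ0 := norm_nonneg Γ
  have hdist : ‖Γ - Γ₂‖ ≤ C₂ * (t + ‖b‖) := by
    refine hΓΓ₂.trans ?_
    rw [hC₂, mul_assoc, mul_assoc]
    gcongr
    calc ‖G x - b - G xbar‖ = ‖(G x - G xbar) - b‖ := by congr 1; abel
      _ ≤ K₄ * t + ‖b‖ := (norm_sub_le _ _).trans (by gcongr; exact hL₄ x hx4)
      _ ≤ (K₄ + 1) * (t + ‖b‖) := by nlinarith
  have hmem : (WithLp.toLp 2 (y, Γ₂) : Mult Y n) ∈ multG2 Y G xbar := hΓ₂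
  have hΓ₂n : ‖Γ₂‖ ≤ R + C₂ * 2 := by
    calc ‖Γ₂‖ = ‖Γ - (Γ - Γ₂)‖ := by congr 1; abel
      _ ≤ ‖Γ‖ + ‖Γ - Γ₂‖ := norm_sub_le _ _
      _ ≤ R + C₂ * (t + ‖b‖) := by gcongr
      _ ≤ _ := by gcongr; linarith
  obtain ⟨m, hm, hTm, hmd⟩ := hres _ hmem ((norm_toLp_le _ _).trans (by gcongr))
  obtain ⟨-, hm1, hm2⟩ := mem_normalCone_psdCone.1 (show m.snd ∈ normalCone _ _ from hm)
  refine ⟨m, mem_multipliers.2 ⟨?_, hh0, hA, hm2, hm1⟩, ?_⟩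
  · rw [hgrad, hTm, sub_self]
  have hresid : ‖T (WithLp.toLp 2 (y, Γ₂)) - -gradient f xbar‖ ≤
      (K₁ + K₂ * R + K₃ * R + 1 + N * C₂) * (t + ‖a₁‖ + ‖b‖) := by
    have hadj1 : ‖ContinuousLinearMap.adjoint (fderiv ℝ h x) y -
        ContinuousLinearMap.adjoint (fderiv ℝ h xbar) y‖ ≤ K₂ * t * R := by
      refine (norm_adjoint_apply_sub_le _ _ _).trans ?_
      gcongr
      exact hL₂ x hx2
    have hadj2 : ‖ContinuousLinearMap.adjoint (fderiv ℝ G x) Γ -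
        ContinuousLinearMap.adjoint (fderiv ℝ G xbar) Γ‖ ≤ K₃ * t * R := by
      refine (norm_adjoint_apply_sub_le _ _ _).trans ?_
      gcongr
      exact hL₃ x hx3
    have hadj3 : ‖ContinuousLinearMap.adjoint (fderiv ℝ G xbar) (Γ - Γ₂)‖ ≤
        N * (C₂ * (t + ‖b‖)) :=
      (hN _).trans (by gcongr)
    rw [gradLagrangian_eq (hdf _) (hdh _) (hdG _), sub_eq_zero] at hz1
    -- The perturbed stationarity equation at x is moved to `xbar`, with one Lipschitz error for
    -- each of f, h, G and one for replacing Γ by Γ₂.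
    have hdecomp : T (WithLp.toLp 2 (y, Γ₂)) - -gradient f xbar =
        a₁ - (gradient f x - gradient f xbar) -
        (ContinuousLinearMap.adjoint (fderiv ℝ h x) y -
          ContinuousLinearMap.adjoint (fderiv ℝ h xbar) y) -
        (ContinuousLinearMap.adjoint (fderiv ℝ G x) Γ -
          ContinuousLinearMap.adjoint (fderiv ℝ G xbar) Γ) -
        ContinuousLinearMap.adjoint (fderiv ℝ G xbar) (Γ - Γ₂) := by
      rw [hTl, ← hz1, map_sub]
      change ContinuousLinearMap.adjoint (fderiv ℝ h xbar) y +
        ContinuousLinearMap.adjoint (fderiv ℝ G xbar) Γ₂ - _ = _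
      abel
    rw [hdecomp]
    have h1 := hL₁ x hx1
    calc _ ≤ ‖a₁‖ + K₁ * t + K₂ * t * R + K₃ * t * R + N * (C₂ * (t + ‖b‖)) := by
          refine (norm_sub_le _ _).trans (add_le_add ?_ hadj3)
          refine (norm_sub_le _ _).trans (add_le_add ?_ hadj2)
          refine (norm_sub_le _ _).trans (add_le_add ?_ hadj1)
          exact (norm_sub_le _ _).trans (by gcongr)
      _ ≤ _ := by
          have e1 : 0 ≤ (K₁ + K₂ * R + K₃ * R) * (‖a₁‖ + ‖b‖) := by positivity
          have e2 : 0 ≤ N * C₂ * ‖a₁‖ := by positivity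
          linarith
  calc ‖WithLp.toLp 2 (y, Γ) - m‖
      ≤ ‖(WithLp.toLp 2 (y, Γ) : Mult Y n) - WithLp.toLp 2 (y, Γ₂)‖ +
          ‖WithLp.toLp 2 (y, Γ₂) - m‖ := norm_sub_le_norm_sub_add_norm_sub _ _ _
    _ ≤ C₂ * (t + ‖a₁‖ + ‖b‖) +
        K * ((K₁ + K₂ * R + K₃ * R + 1 + N * C₂) * (t + ‖a₁‖ + ‖b‖)) := by
        refine add_le_add ?_ (hmd.trans (by gcongr))
        rw [← WithLp.toLp_sub, Prod.mk_sub_mk, sub_self]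
        refine (norm_toLp_le _ _).trans ?_
        rw [norm_zero, zero_add]
        refine hdist.trans ?_
        gcongr
        linarith
    _ = _ := by ring

end Calculus

/-! ### Second order analysis along sequences of perturbed solutions -/

theorem tendsto_difference_quotient {E F : Type*} [NormedAddCommGroup E] [NormedSpace ℝ E]
    [NormedAddCommGroup F] [NormedSpace ℝ F] {g : E → F} {g' : E →L[ℝ] F} {x d : E}
    (hg : HasFDerivAt g g' x) {t : ℕ → ℝ} {e : ℕ → E} (ht : ∀ k, 0 < t k)
    (ht0 : Tendsto t atTop (𝓝 0)) (he : Tendsto e atTop (𝓝 d)) :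
    Tendsto (fun k => (t k)⁻¹ • (g (x + t k • e k) - g x)) atTop (𝓝 (g' d)) := by
  refine (hasFDerivWithinAt_univ.2 hg).lim (d := fun k => t k • e k) ?_ (.of_forall fun _ => trivial)
    ?_
  · simpa using ht0.smul he
  · simpa only [inv_smul_smul₀ (ht _).ne'] using he

theorem tendsto_clm_apply {E F : Type*} [NormedAddCommGroup E] [NormedSpace ℝ E]
    [NormedAddCommGroup F] [NormedSpace ℝ F] {T : ℕ → E →L[ℝ] F} {T₀ : E →L[ℝ] F} {e : ℕ → E}
    {d : E} (hT : Tendsto T atTop (𝓝 T₀)) (he : Tendsto e atTop (𝓝 d)) :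
    Tendsto (fun k => T k (e k)) atTop (𝓝 (T₀ d)) :=
  (isBoundedBilinearMap_apply.continuous.tendsto (T₀, d)).comp (hT.prodMk_nhds he)

theorem tendsto_inner_zero_of_bounded {E : Type*} [NormedAddCommGroup E] [InnerProductSpace ℝ E]
    {u v : ℕ → E} {B : ℝ} (hu : ∀ᶠ k in atTop, ‖u k‖ ≤ B) (hv : Tendsto v atTop (𝓝 0)) :
    Tendsto (fun k => inner ℝ (u k) (v k)) atTop (𝓝 0) := by
  refine squeeze_zero_norm' (a := fun k => B * ‖v k‖) ?_ (by simpa using hv.norm.const_mul B)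
  filter_upwards [hu] with k hk
  exact (norm_inner_le_norm _ _).trans (by gcongr)

section Sequences

variable {X : Type*} [NormedAddCommGroup X] [InnerProductSpace ℝ X] [CompleteSpace X]
  {Y : Type*} [NormedAddCommGroup Y] [InnerProductSpace ℝ Y] [CompleteSpace Y] {n : ℕ}

/-- The multipliers move with k, so differentiability of one fixed Lagrangian is not enough. The
gradient is affine in the multipliers, and the quotient splits into difference quotients of ∇f, h'
and G'. -/
theorem tendsto_gradLagrangian_quotient {f : X → ℝ} {h : X → Y} {G : X → SymMat n}
    (hf : ContDiff ℝ 2 f) (hh : ContDiff ℝ 2 h) (hG : ContDiff ℝ 2 G) {xbar d : X} {ybar : Y}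
    {Γbar : SymMat n} {t : ℕ → ℝ} {e : ℕ → X} {y : ℕ → Y} {Γ : ℕ → SymMat n}
    (ht : ∀ k, 0 < t k) (ht0 : Tendsto t atTop (𝓝 0)) (he : Tendsto e atTop (𝓝 d))
    (hy : Tendsto y atTop (𝓝 ybar)) (hΓ : Tendsto Γ atTop (𝓝 Γbar)) :
    Tendsto (fun k => inner ℝ ((t k)⁻¹ • (gradLagrangian f h G (xbar + t k • e k) (y k) (Γ k) -
      gradLagrangian f h G xbar (y k) (Γ k))) (e k)) atTop
      (𝓝 (inner ℝ (hessLagrangian f h G xbar ybar Γbar d) d)) := by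
  have hdf := hf.differentiable (by norm_num)
  have hdh := hh.differentiable (by norm_num)
  have hdG := hG.differentiable (by norm_num)
  have hdh' : Differentiable ℝ (fderiv ℝ h) :=
    (hh.fderiv_right (m := 1) (by norm_num)).differentiable (by norm_num)
  have hdG' : Differentiable ℝ (fderiv ℝ G) :=
    (hG.fderiv_right (m := 1) (by norm_num)).differentiable (by norm_num)
  have key : ∀ (y : ℕ → Y) (Γ : ℕ → SymMat n), Tendsto y atTop (𝓝 ybar) →
      Tendsto Γ atTop (𝓝 Γbar) →
      Tendsto (fun k => inner ℝ ((t k)⁻¹ • (gradLagrangian f h G (xbar + t k • e k) (y k) (Γ k) -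
        gradLagrangian f h G xbar (y k) (Γ k))) (e k)) atTop
        (𝓝 (inner ℝ (fderiv ℝ (gradient f) xbar d) d +
          inner ℝ ybar (fderiv ℝ (fderiv ℝ h) xbar d d) +
          inner ℝ Γbar (fderiv ℝ (fderiv ℝ G) xbar d d))) := by
    intro y Γ hy hΓ
    have l1 := (tendsto_difference_quotient (differentiable_gradient hf xbar).hasFDerivAt
      ht ht0 he).inner he (𝕜 := ℝ)
    have l2 := hy.inner (𝕜 := ℝ)
      (tendsto_clm_apply (tendsto_difference_quotient (hdh' xbar).hasFDerivAt ht ht0 he) he)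
    have l3 := hΓ.inner (𝕜 := ℝ)
      (tendsto_clm_apply (tendsto_difference_quotient (F := X →L[ℝ] SymMat n)
        (hdG' xbar).hasFDerivAt ht ht0 he) he)
    refine ((l1.add l2).add l3).congr fun k => ?_
    rw [gradLagrangian_eq (hdf _) (hdh _) (hdG _), gradLagrangian_eq (hdf _) (hdh _) (hdG _)]
    simp only [real_inner_smul_left, real_inner_smul_right, SymMat.inner_smul_right, inner_add_left, inner_sub_left,
      inner_sub_right, smul_apply, sub_apply,
      ContinuousLinearMap.adjoint_inner_left]
    ring
  -- With constant multipliers the same quotient also converges to the Hessian form; uniqueness of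
  -- limits identifies it without computing the Hessian.
  have l1 := (tendsto_difference_quotient
    (hasFDerivAt_gradLagrangian hf hh hG xbar ybar Γbar) ht ht0 he).inner he (𝕜 := ℝ)
  rw [tendsto_nhds_unique l1 (key _ _ tendsto_const_nhds tendsto_const_nhds)]
  exact key y Γ hy hΓ

/-- The limit direction of a sequence of solutions of perturbed problems, with perturbations
negligible with respect to the displacement, is critical and violates the second order sufficient
condition. -/
theorem critical_and_second_order_of_seq [FiniteDimensional ℝ Y] {f : X → ℝ} {h : X → Y}
    {G : X → SymMat n} (hf : ContDiff ℝ 2 f) (hh : ContDiff ℝ 2 h) (hG : ContDiff ℝ 2 G)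
    {xbar d : X} {ybar : Y} {Γbar : SymMat n}
    (hM : WithLp.toLp 2 (ybar, Γbar) ∈ multipliers f h G xbar)
    (hri : (multG1 f h G xbar ∩ intrinsicInterior ℝ (multG2 Y G xbar)).Nonempty)
    {t : ℕ → ℝ} {e : ℕ → X} {y : ℕ → Y} {Γ : ℕ → SymMat n} {a₁ : ℕ → X} {a₂ : ℕ → Y}
    {b : ℕ → SymMat n} (ht : ∀ k, 0 < t k) (ht0 : Tendsto t atTop (𝓝 0))
    (he1 : ∀ k, ‖e k‖ = 1) (he : Tendsto e atTop (𝓝 d))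
    (hy : Tendsto y atTop (𝓝 ybar)) (hΓ : Tendsto Γ atTop (𝓝 Γbar))
    (ha₁ : Tendsto (fun k => (t k)⁻¹ • a₁ k) atTop (𝓝 0))
    (ha₂ : Tendsto (fun k => (t k)⁻¹ • a₂ k) atTop (𝓝 0))
    (hb : Tendsto (fun k => (t k)⁻¹ • b k) atTop (𝓝 0))
    (hz : ∀ k, triple (xbar + t k • e k) (y k) (Γ k) ∈ kktSol f h G (a₁ k) (a₂ k) (b k)) :
    d ∈ problemCriticalCone h G xbar Γbar ∧
      inner ℝ (hessLagrangian f h G xbar ybar Γbar d) d -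
        sigmaTerm (G xbar) Γbar (fderiv ℝ G xbar d) ≤ 0 := by
  have hdf := hf.differentiable (by norm_num)
  have hdh := hh.differentiable (by norm_num)
  have hdG := hG.differentiable (by norm_num)
  have hstat : IsStationary f h G xbar := ⟨ybar, Γbar, hM⟩
  obtain ⟨-, hh0, hA, hΓA, hΓn⟩ := mem_multipliers.1 hM
  change inner ℝ Γbar (G xbar) = 0 at hΓA
  change Γbar ∈ nsdCone n at hΓn
  have hkkt := fun k => mem_kktSol.1 (hz k)
  set A := G xbar with hAdef
  set D := fderiv ℝ G xbar d with hD
  have htne : ∀ k, t k ≠ 0 := fun k => (ht k).ne'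
  have hhd : fderiv ℝ h xbar d = 0 := by
    refine tendsto_nhds_unique (tendsto_difference_quotient (hdh xbar).hasFDerivAt ht ht0 he) ?_
    refine ha₂.congr fun k => ?_
    rw [hh0, sub_zero, sub_eq_zero.1 (hkkt k).2.1]
  -- Absorbing b into H makes G(x) - b = A + tH exact, while b = o(t) keeps the limit D.
  set H : ℕ → SymMat n := fun k => (t k)⁻¹ • (G (xbar + t k • e k) - b k - A) with hH
  have hXH : ∀ k, G (xbar + t k • e k) - b k = A + t k • H k := by
    intro k
    rw [hH]
    simp only [smul_inv_smul₀ (htne k)]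
    abel
  have hHlim : Tendsto H atTop (𝓝 D) := by
    have := (tendsto_difference_quotient (hdG xbar).hasFDerivAt ht ht0 he).sub hb
    rw [sub_zero] at this
    refine this.congr fun k => ?_
    rw [hH, ← smul_sub]
    congr 1
    abel
  clear_value H
  have hXpsd : ∀ k, A + t k • H k ∈ psdCone n := fun k => hXH k ▸ (hkkt k).2.2.1
  have hcompl : ∀ k, inner ℝ (Γ k) (A + t k • H k) = 0 := fun k => by
    rw [← hXH k, real_inner_comm]
    exact (hkkt k).2.2.2.1
  have hΓnsd : ∀ k, Γ k ∈ nsdCone n := fun k => (hkkt k).2.2.2.2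
  -- One sign comes from pairing A + tH with `Γbar`, orthogonal to A; the other from Γ k, which is
  -- orthogonal to A + tH and pairs nonpositively with A.
  have hΓD : inner ℝ Γbar D = 0 := by
    apply le_antisymm
    · refine le_of_tendsto (tendsto_const_nhds.inner hHlim) (.of_forall fun k => ?_)
      have := inner_nonpos_of_mem_nsdCone (hXpsd k) hΓn
      rw [inner_add_right, hΓA, zero_add, SymMat.inner_smul_right] at this
      exact nonpos_of_mul_nonpos_right this (ht k)
    · refine ge_of_tendsto (hΓ.inner hHlim) (.of_forall fun k => ?_)
      have h1 := hcompl k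
      have h2 := inner_nonpos_of_mem_nsdCone hA (hΓnsd k)
      rw [inner_add_right, SymMat.inner_smul_right] at h1
      exact nonneg_of_mul_nonneg_right (by linarith) (ht k)
  refine ⟨⟨hhd, ⟨t, H, ht, ht0, hHlim, hXpsd⟩, hΓD⟩, ?_⟩
  obtain ⟨C, hC, r, hr, hnear⟩ := exists_multiplier_near hf hh hG hstat hri
    (R := ‖ybar‖ + ‖Γbar‖ + 1) (by positivity)
  have hb0 : Tendsto b atTop (𝓝 0) := by
    have := ht0.smul hb
    rw [zero_smul] at this
    exact this.congr fun k => smul_inv_smul₀ (htne k) _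
  have hnorm : ∀ k, ‖xbar + t k • e k - xbar‖ = t k := fun k => by
    rw [add_sub_cancel_left, norm_smul, he1, mul_one, Real.norm_of_nonneg (ht k).le]
  have hexists : ∀ᶠ k in atTop, ∃ l : Mult Y n, l ∈ multipliers f h G xbar ∧
      ‖WithLp.toLp 2 (y k, Γ k) - l‖ ≤ C * (t k + ‖a₁ k‖ + ‖b k‖) := by
    filter_upwards [(hb0.norm.eventually_lt_const (show ‖(0 : SymMat n)‖ < 1 by simp)),
      ht0.eventually_lt_const hr,
      hy.norm.eventually_lt_const (show ‖ybar‖ < ‖ybar‖ + ‖Γbar‖ + 1 by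
        linarith [norm_nonneg Γbar]),
      hΓ.norm.eventually_lt_const (show ‖Γbar‖ < ‖ybar‖ + ‖Γbar‖ + 1 by
        linarith [norm_nonneg ybar])] with k k1 k2 k3 k4
    have := hnear _ _ _ _ _ _ (hz k) k1.le ((hnorm k).trans_lt k2) k3.le k4.le
    rwa [hnorm k] at this
  obtain ⟨l, hl⟩ := hexists.choice
  -- Scaled multiplier errors. They need only be bounded, since they are paired with quantities
  -- tending to zero; the bound 3C comes from t, ‖a₁‖ and ‖b‖ each being eventually at most t.
  set η : ℕ → Y := fun k => (t k)⁻¹ • (y k - (l k).fst) with hη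
  set ζ : ℕ → SymMat n := fun k => (t k)⁻¹ • (Γ k - (l k).snd) with hζ
  have hbound : ∀ᶠ k in atTop, ‖(t k)⁻¹ • ((WithLp.toLp 2 (y k, Γ k) : Mult Y n) - l k)‖ ≤
      C * 3 := by
    filter_upwards [hl, ha₁.norm.eventually_lt_const (show ‖(0 : X)‖ < 1 by simp),
      hb.norm.eventually_lt_const (show ‖(0 : SymMat n)‖ < 1 by simp)] with k hk k1 k2
    have hti : ‖(t k)⁻¹‖ = (t k)⁻¹ := Real.norm_of_nonneg (inv_nonneg.2 (ht k).le)
    rw [norm_smul, hti] at k1 k2 ⊢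
    calc (t k)⁻¹ * ‖(WithLp.toLp 2 (y k, Γ k) : Mult Y n) - l k‖
        ≤ (t k)⁻¹ * (C * (t k + ‖a₁ k‖ + ‖b k‖)) :=
          mul_le_mul_of_nonneg_left hk.2 (inv_nonneg.2 (ht k).le)
      _ = C * (1 + (t k)⁻¹ * ‖a₁ k‖ + (t k)⁻¹ * ‖b k‖) := by
          have := htne k
          field_simp
      _ ≤ C * 3 := by gcongr; linarith
  have hηb : ∀ᶠ k in atTop, ‖η k‖ ≤ C * 3 := hbound.mono fun k hk => (norm_fst_le _).trans hk
  have hζb : ∀ᶠ k in atTop, ‖ζ k‖ ≤ C * 3 := hbound.mono fun k hk => (norm_snd_le _).trans hk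
  have hΓ'lim : Tendsto (fun k => (l k).snd) atTop (𝓝 Γbar) := by
    have h0 : Tendsto (fun k => t k • ζ k) atTop (𝓝 0) := by
      refine squeeze_zero_norm' (a := fun k => t k * (C * 3)) ?_ (by simpa using ht0.mul_const _)
      filter_upwards [hζb] with k hk
      rw [norm_smul, Real.norm_of_nonneg (ht k).le]
      exact mul_le_mul_of_nonneg_left hk (ht k).le
    have := hΓ.sub h0
    rw [sub_zero] at this
    refine this.congr fun k => ?_
    rw [hζ]
    simp only [smul_inv_smul₀ (htne k), sub_sub_cancel]
  -- limits of the individual terms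
  have L0 : Tendsto (fun k => inner ℝ ((t k)⁻¹ • a₁ k) (e k)) atTop (𝓝 0) := by
    simpa using ha₁.inner he (𝕜 := ℝ)
  have L1 := tendsto_gradLagrangian_quotient hf hh hG (xbar := xbar) ht ht0 he hy hΓ
  have L2 : Tendsto (fun k => inner ℝ (η k) (fderiv ℝ h xbar (e k))) atTop (𝓝 0) := by
    refine tendsto_inner_zero_of_bounded hηb ?_
    rw [← hhd]
    exact ((fderiv ℝ h xbar).continuous.tendsto d).comp he
  have L3 : Tendsto (fun k => inner ℝ (ζ k) (fderiv ℝ G xbar (e k) - H k)) atTop (𝓝 0) := by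
    refine tendsto_inner_zero_of_bounded hζb ?_
    have := (((fderiv ℝ G xbar).continuous.tendsto d).comp he).sub hHlim
    rwa [sub_self] at this
  have hcm := SymMat.continuous_mat (n := n)
  have hq : Continuous fun p : SymMat n × SymMat n =>
      (p.1.mat * (p.2.mat * A.pinv * p.2.mat)).trace := by fun_prop
  have hc : Continuous fun p : SymMat n × SymMat n =>
      (p.1.mat * (p.2.mat * A.pinv * p.2.mat * A.pinv * p.2.mat)).trace := by fun_prop
  -- Γ k and the multiplier part of `l k` both tend to `Γbar`, so the two quadratic terms share a
  -- limit and together give the factor 2 of the σ-term.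
  have Q1 := (hq.tendsto (Γbar, D)).comp (hΓ.prodMk_nhds hHlim)
  have Q2 := (hq.tendsto (Γbar, D)).comp (hΓ'lim.prodMk_nhds hHlim)
  have Q3 := ht0.mul ((hc.tendsto (Γbar, D)).comp (hΓ'lim.prodMk_nhds hHlim))
  have L4 := ((Q1.neg.sub Q2).add Q3)
  have hle : ∀ᶠ k in atTop,
      inner ℝ ((t k)⁻¹ • (gradLagrangian f h G (xbar + t k • e k) (y k) (Γ k) -
        gradLagrangian f h G xbar (y k) (Γ k))) (e k) + inner ℝ (η k) (fderiv ℝ h xbar (e k)) +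
      inner ℝ (ζ k) (fderiv ℝ G xbar (e k) - H k) +
      (-((Γ k).mat * ((H k).mat * A.pinv * (H k).mat)).trace -
        ((l k).snd.mat * ((H k).mat * A.pinv * (H k).mat)).trace +
        t k * ((l k).snd.mat *
          ((H k).mat * A.pinv * (H k).mat * A.pinv * (H k).mat)).trace) ≤
      inner ℝ ((t k)⁻¹ • a₁ k) (e k) := by
    filter_upwards [hl] with k hk
    obtain ⟨hl1, -, -, hl4, hl5⟩ := mem_multipliers.1 hk.1
    have hΓk : inner ℝ (Γ k) A = _ :=
      inner_eq_sq_mul_of_complementary (mat_mul_mat_eq_zero (hXpsd k) (hΓnsd k) (hcompl k))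
    have hlk := inner_le_of_complementary hl5 (mat_mul_mat_eq_zero hA hl5 hl4) (hXpsd k)
    have hζH : -((Γ k).mat * ((H k).mat * A.pinv * (H k).mat)).trace -
        ((l k).snd.mat * ((H k).mat * A.pinv * (H k).mat)).trace +
        t k * ((l k).snd.mat *
          ((H k).mat * A.pinv * (H k).mat * A.pinv * (H k).mat)).trace ≤ inner ℝ (ζ k) (H k) := by
      have e1 : inner ℝ (ζ k) (H k) =
          (t k ^ 2)⁻¹ * (-inner ℝ (Γ k) A - inner ℝ (l k).snd (A + t k • H k)) := by
        have h1 := hcompl k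
        rw [inner_add_right, SymMat.inner_smul_right] at h1
        rw [inner_add_right, hl4, SymMat.inner_smul_right, hζ, SymMat.inner_smul_left,
          inner_sub_left, neg_eq_of_add_eq_zero_right h1]
        have := htne k
        field_simp
        ring
      rw [e1, hΓk, le_inv_mul_iff₀ (pow_pos (ht k) 2)]
      linarith
    have hgr : gradLagrangian f h G (xbar + t k • e k) (y k) (Γ k) = a₁ k :=
      sub_eq_zero.1 (hkkt k).1
    -- The difference of the stationarity equations at (x, y, Γ) and at (`xbar`, `l k`), paired with
    -- the direction.
    have hid : inner ℝ ((t k)⁻¹ • (gradLagrangian f h G (xbar + t k • e k) (y k) (Γ k) -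
        gradLagrangian f h G xbar (y k) (Γ k))) (e k) + inner ℝ (η k) (fderiv ℝ h xbar (e k)) +
        inner ℝ (ζ k) (fderiv ℝ G xbar (e k)) = inner ℝ ((t k)⁻¹ • a₁ k) (e k) := by
      rw [hgr, ← sub_zero (gradLagrangian f h G xbar (y k) (Γ k)), ← hl1,
        gradLagrangian_eq (hdf _) (hdh _) (hdG _), gradLagrangian_eq (hdf _) (hdh _) (hdG _)]
      simp only [hη, hζ, real_inner_smul_left, SymMat.inner_smul_left, inner_add_left, inner_sub_left,
        ContinuousLinearMap.adjoint_inner_left]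
      ring
    rw [inner_sub_right]
    linarith
  have hfinal := le_of_tendsto_of_tendsto (((L1.add L2).add L3).add L4) L0 hle
  rw [sigmaTerm]
  simp only at hfinal
  linarith

/-- Lipschitz estimate for the primal part of the solutions of perturbed problems. -/
theorem exists_primal_bound [FiniteDimensional ℝ X] [FiniteDimensional ℝ Y] {f : X → ℝ}
    {h : X → Y} {G : X → SymMat n} (hf : ContDiff ℝ 2 f) (hh : ContDiff ℝ 2 h)
    (hG : ContDiff ℝ 2 G) {xbar : X} {ybar : Y} {Γbar : SymMat n}
    (hM : WithLp.toLp 2 (ybar, Γbar) ∈ multipliers f h G xbar)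
    (hSOSC : SOSC f h G xbar ybar Γbar)
    (hri : (multG1 f h G xbar ∩ intrinsicInterior ℝ (multG2 Y G xbar)).Nonempty) :
    ∃ κ : ℝ, 0 < κ ∧ ∃ ρ : ℝ, 0 < ρ ∧ ∀ (a₁ : X) (a₂ : Y) (b : SymMat n) (x : X) (y : Y)
      (Γ : SymMat n), triple x y Γ ∈ kktSol f h G a₁ a₂ b →
        ‖triple x y Γ - triple xbar ybar Γbar‖ < ρ → ‖x - xbar‖ ≤ κ * ‖triple a₁ a₂ b‖ := by
  by_contra! hcon
  -- Failure for the constant k + 1 on the ball of radius 1/(k + 1) gives convergence to the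
  -- reference triple and perturbations of size at most t/(k + 1).
  choose a₁ a₂ b x y Γ hz hball hgt using fun k : ℕ =>
    hcon ((k : ℝ) + 1) (by positivity) (1 / ((k : ℝ) + 1)) (by positivity)
  set t : ℕ → ℝ := fun k => ‖x k - xbar‖ with htdef
  have ht : ∀ k, 0 < t k := fun k => lt_of_le_of_lt (by positivity) (hgt k)
  set e : ℕ → X := fun k => (t k)⁻¹ • (x k - xbar) with hedef
  have he1 : ∀ k, ‖e k‖ = 1 := fun k => by
    rw [hedef, norm_smul, norm_inv, Real.norm_of_nonneg (ht k).le]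
    exact inv_mul_cancel₀ (ht k).ne'
  have hxe : ∀ k, xbar + t k • e k = x k := fun k => by
    rw [hedef]
    simp only [smul_inv_smul₀ (ht k).ne', add_sub_cancel]
  have hlim0 : Tendsto (fun k : ℕ => triple (x k) (y k) (Γ k) - triple xbar ybar Γbar) atTop
      (𝓝 0) :=
    squeeze_zero_norm (fun k => (hball k).le) tendsto_one_div_add_atTop_nhds_zero_nat
  have hx0 : Tendsto (fun k => x k - xbar) atTop (𝓝 0) :=
    squeeze_zero_norm (fun k => norm_fst_le (triple (x k) (y k) (Γ k) - triple xbar ybar Γbar))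
      (by simpa using hlim0.norm)
  have hy0 : Tendsto (fun k => y k - ybar) atTop (𝓝 0) :=
    squeeze_zero_norm (fun k => (norm_fst_le
      (triple (x k) (y k) (Γ k) - triple xbar ybar Γbar).snd).trans (norm_snd_le _))
      (by simpa using hlim0.norm)
  have hΓ0 : Tendsto (fun k => Γ k - Γbar) atTop (𝓝 0) :=
    squeeze_zero_norm (fun k => (norm_snd_le
      (triple (x k) (y k) (Γ k) - triple xbar ybar Γbar).snd).trans (norm_snd_le _))
      (by simpa using hlim0.norm)
  have ht0 : Tendsto t atTop (𝓝 0) := by simpa using hx0.norm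
  have hp0 : Tendsto (fun k => (t k)⁻¹ • triple (a₁ k) (a₂ k) (b k)) atTop (𝓝 0) := by
    refine squeeze_zero_norm (fun k => ?_) tendsto_one_div_add_atTop_nhds_zero_nat
    rw [norm_smul, norm_inv, Real.norm_of_nonneg (ht k).le, inv_mul_le_iff₀ (ht k),
      mul_one_div, le_div_iff₀ (by positivity), mul_comm]
    exact (hgt k).le
  have ha₁0 : Tendsto (fun k => (t k)⁻¹ • a₁ k) atTop (𝓝 0) :=
    squeeze_zero_norm (fun k => norm_fst_le ((t k)⁻¹ • triple (a₁ k) (a₂ k) (b k)))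
      (by simpa using hp0.norm)
  have ha₂0 : Tendsto (fun k => (t k)⁻¹ • a₂ k) atTop (𝓝 0) :=
    squeeze_zero_norm (fun k => (norm_fst_le
      ((t k)⁻¹ • triple (a₁ k) (a₂ k) (b k)).snd).trans (norm_snd_le _))
      (by simpa using hp0.norm)
  have hb0 : Tendsto (fun k => (t k)⁻¹ • b k) atTop (𝓝 0) :=
    squeeze_zero_norm (fun k => (norm_snd_le
      ((t k)⁻¹ • triple (a₁ k) (a₂ k) (b k)).snd).trans (norm_snd_le _))
      (by simpa using hp0.norm)
  have := FiniteDimensional.proper ℝ X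
  obtain ⟨d, hd, φ, hφ, hφlim⟩ := (isCompact_sphere (0 : X) 1).tendsto_subseq
    (x := e) fun k => by simpa using he1 k
  have hφt := hφ.tendsto_atTop
  obtain ⟨hcrit, hle⟩ := critical_and_second_order_of_seq hf hh hG hM hri
    (t := t ∘ φ) (e := e ∘ φ) (y := y ∘ φ) (Γ := Γ ∘ φ) (a₁ := a₁ ∘ φ) (a₂ := a₂ ∘ φ) (b := b ∘ φ)
    (fun k => ht _) (ht0.comp hφt) (fun k => he1 _) hφlim
    ((tendsto_sub_nhds_zero_iff.1 hy0).comp hφt) ((tendsto_sub_nhds_zero_iff.1 hΓ0).comp hφt)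
    (ha₁0.comp hφt) (ha₂0.comp hφt) (hb0.comp hφt)
    (fun k => by
      simp only [Function.comp_apply, hxe]
      exact hz _)
  have hd0 : d ≠ 0 := by
    rintro rfl
    simp at hd
  exact absurd (hSOSC d hcrit hd0) (not_lt.2 hle)

end Sequences

end NLSDP

/-! ### Semi-isolated calmness -/

theorem mainTheorem3
    {X : Type*} [NormedAddCommGroup X] [InnerProductSpace ℝ X] [FiniteDimensional ℝ X]
    [CompleteSpace X]
    {Y : Type*} [NormedAddCommGroup Y] [InnerProductSpace ℝ Y] [FiniteDimensional ℝ Y]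
    [CompleteSpace Y]
    {n : ℕ} (f : X → ℝ) (h : X → Y) (G : X → NLSDP.SymMat n)
    (hf : ContDiff ℝ 2 f) (hh : ContDiff ℝ 2 h) (hG : ContDiff ℝ 2 G)
    (xbar : X) (hx : NLSDP.IsStationary f h G xbar)
    (ybar : Y) (Γbar : NLSDP.SymMat n)
    (hM : WithLp.toLp 2 (ybar, Γbar) ∈ NLSDP.multipliers f h G xbar)
    (hSOSC : NLSDP.SOSC f h G xbar ybar Γbar)
    (hri : (NLSDP.multG1 f h G xbar ∩ intrinsicInterior ℝ (NLSDP.multG2 Y G xbar)).Nonempty) :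
    ∃ κ₁ : ℝ, 0 < κ₁ ∧ ∃ r₁ : ℝ, 0 < r₁ ∧
      ∃ U : Set (NLSDP.Triple X Y n), IsOpen U ∧ NLSDP.triple 0 0 0 ∈ U ∧
        ∀ (a₁ : X) (a₂ : Y) (b : NLSDP.SymMat n), NLSDP.triple a₁ a₂ b ∈ U →
          ∀ (x : X) (y : Y) (Γ : NLSDP.SymMat n),
            NLSDP.triple x y Γ ∈ NLSDP.kktSol f h G a₁ a₂ b →
            NLSDP.triple x y Γ ∈ Metric.ball (NLSDP.triple xbar ybar Γbar) r₁ →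
            ‖x - xbar‖ +
                Metric.infDist (WithLp.toLp 2 (y, Γ)) (NLSDP.multipliers f h G xbar) ≤
              κ₁ * ‖NLSDP.triple a₁ a₂ b‖ := by

  obtain ⟨κ, hκ, ρ, hρ, hprimal⟩ := NLSDP.exists_primal_bound hf hh hG hM hSOSC hri
  obtain ⟨C, hC, r, hr, hnear⟩ := NLSDP.exists_multiplier_near hf hh hG hx hri
    (R := ‖ybar‖ + ‖Γbar‖ + 1) (by positivity)
  -- The multiplier distance is at most C(‖x - xbar‖ + ‖a₁‖ + ‖b‖), whose terms contribute κ, 1 and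
  -- 1. The two unit radii ensure ‖b‖ ≤ 1 and the bound R on y and Γ.
  refine ⟨κ + C * (κ + 2), by positivity, min ρ (min r 1), by positivity,
    Metric.ball (NLSDP.triple 0 0 0) 1, Metric.isOpen_ball, Metric.mem_ball_self one_pos, ?_⟩
  intro a₁ a₂ b hp x y Γ hz hball
  rw [Metric.mem_ball, dist_eq_norm] at hp hball
  have hp' : ‖NLSDP.triple a₁ a₂ b‖ < 1 := by
    have : NLSDP.triple a₁ a₂ b - NLSDP.triple 0 0 0 = NLSDP.triple a₁ a₂ b := sub_zero _
    rwa [this] at hp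
  have ha₁ : ‖a₁‖ ≤ ‖NLSDP.triple a₁ a₂ b‖ := NLSDP.norm_fst_le (NLSDP.triple a₁ a₂ b)
  have hb : ‖b‖ ≤ ‖NLSDP.triple a₁ a₂ b‖ :=
    (NLSDP.norm_snd_le (NLSDP.triple a₁ a₂ b).snd).trans (NLSDP.norm_snd_le _)
  have hxn : ‖x - xbar‖ ≤ ‖NLSDP.triple x y Γ - NLSDP.triple xbar ybar Γbar‖ :=
    NLSDP.norm_fst_le (NLSDP.triple x y Γ - NLSDP.triple xbar ybar Γbar)
  have hyn : ‖y - ybar‖ ≤ ‖NLSDP.triple x y Γ - NLSDP.triple xbar ybar Γbar‖ :=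
    (NLSDP.norm_fst_le (NLSDP.triple x y Γ - NLSDP.triple xbar ybar Γbar).snd).trans
      (NLSDP.norm_snd_le _)
  have hΓn : ‖Γ - Γbar‖ ≤ ‖NLSDP.triple x y Γ - NLSDP.triple xbar ybar Γbar‖ :=
    (NLSDP.norm_snd_le (NLSDP.triple x y Γ - NLSDP.triple xbar ybar Γbar).snd).trans
      (NLSDP.norm_snd_le _)
  obtain ⟨hb1, hb2⟩ := lt_min_iff.1 hball
  obtain ⟨hb2, hb3⟩ := lt_min_iff.1 hb2
  have hx' := hprimal a₁ a₂ b x y Γ hz hb1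
  obtain ⟨l, hl, hdist⟩ := hnear a₁ a₂ b x y Γ hz (hb.trans hp'.le) (hxn.trans_lt hb2)
    (by linarith [norm_le_norm_add_norm_sub' y ybar, norm_nonneg Γbar])
    (by linarith [norm_le_norm_add_norm_sub' Γ Γbar, norm_nonneg ybar])
  have hinf := Metric.infDist_le_dist_of_mem (x := WithLp.toLp 2 (y, Γ)) hl
  rw [dist_eq_norm] at hinf
  calc _ ≤ κ * ‖NLSDP.triple a₁ a₂ b‖ + C * (κ * ‖NLSDP.triple a₁ a₂ b‖ +
        ‖NLSDP.triple a₁ a₂ b‖ + ‖NLSDP.triple a₁ a₂ b‖) := by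
        refine add_le_add hx' (hinf.trans (hdist.trans ?_))
        gcongr
    _ = _ := by ring
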